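/- Let $(X,d)$ be a complete $\mathrm{CAT}(1)$ space that is admissible, i.e. $d(w,w')<\pi/2$ for all $w,w'\in X$, and let $f\colon X\to(-\infty,\infty]$ be a proper lower semicontinuous convex function, where convexity means $f(\alpha x\oplus(1-\alpha)y)\le\alpha f(x)+(1-\alpha)f(y)$ for all $x,y\in X$ and $\alpha\in(0,1)$. Here, for $\alpha\in[0,1]$, $\alpha x\oplus(1-\alpha)y$ denotes the point at distance $(1-\alpha)d(x,y)$ from $x$ on the geodesic from $x$ to $y$. Write $\operatorname{Argmin}f$ for the set of minimizers of $f$ on $X$. For $\eta>0$ let $R_{\eta f}$ be the resolvent of $\eta f$, i.e. for $x\in X$ the point $R_{\eta f}x$ is the unique minimizer of $y\mapsto \eta f(y)+\tan d(y,x)\,\sin d(y,x)$ on $X$. Let $v\in X$, let $\{\alpha_n\}_{n\ge1}$ be a sequence in $[0,1]$, let $\{\lambda_n\}_{n\ge1}$ be a sequence of positive real numbers with $\lim_n\lambda_n=\infty$, and let $\{y_n\}$ be defined by $y_1\in X$ and $$y_{n+1}=\alpha_n v\oplus(1-\alpha_n)R_{\lambda_n f}y_n\qquad(n=1,2,\dots).$$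 Then the following hold. (i) $\operatorname{Argmin}f$ is nonempty if and only if $\{R_{\lambda_n f}y_n\}$ is spherically bounded, i.e. $\inf_{y\in X}\limsup_{n\to\infty}d(y,R_{\lambda_n f}y_n)<\pi/2$, and $\sup_n d(R_{\lambda_n f}y_n,y_n)<\pi/2$. (ii) If $\operatorname{Argmin}f$ is nonempty, $\lim_n\alpha_n=0$ and $\sum_{n=1}^\infty\alpha_n^2=\infty$, then both $\{y_n\}$ and $\{R_{\lambda_n f}y_n\}$ converge in the metric of $X$ to $Pv$, where $P$ is the metric projection of $X$ onto $\operatorname{Argmin}f$, i.e. $Pv$ is the unique point of $\operatorname{Argmin}f$ nearest to $v$. -/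

import Mathlib

open Filter Topology

/-- `c` (restricted to `[0, d x y]`) is a geodesic path from `x` to `y` for the distance
function `d`. -/
def IsGeodesicPath {Y : Type*} (d : Y → Y → ℝ) (x y : Y) (c : ℝ → Y) : Prop :=
  c 0 = x ∧ c (d x y) = y ∧
    ∀ s ∈ Set.Icc (0 : ℝ) (d x y), ∀ t ∈ Set.Icc (0 : ℝ) (d x y), d (c s) (c t) = |s - t|

/-- The unit sphere of three-dimensional Euclidean space. -/
abbrev Sphere2 : Type := Metric.sphere (0 : EuclideanSpace ℝ (Fin 3)) 1

/-- The spherical (angular) distance on the unit sphere. -/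
noncomputable def sphereDist (x y : Sphere2) : ℝ :=
  Real.arccos (inner ℝ (x : EuclideanSpace ℝ (Fin 3)) (y : EuclideanSpace ℝ (Fin 3)))

/-- `X` is a CAT(1) space: it is `π`-geodesic, and every geodesic triangle of perimeter less
than `2π` is at least as thin as each of its comparison triangles in the unit sphere. The three
sides are the geodesic paths `c i` from `x i` to `x (i + 1)`, with indices modulo `3`; the
comparison point of `c i s` is `c' i s`, the point of the corresponding side of the comparison
triangle that lies at distance `s` from the vertex `x' i`. -/
structure IsCAT1 (X : Type*) [MetricSpace X] : Prop where
  exists_geodesic : ∀ x y : X, dist x y < Real.pi → ∃ c : ℝ → X, IsGeodesicPath dist x y c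
  comparison : ∀ (x : Fin 3 → X) (c : Fin 3 → ℝ → X)
      (x' : Fin 3 → Sphere2) (c' : Fin 3 → ℝ → Sphere2),
    dist (x 0) (x 1) + dist (x 1) (x 2) + dist (x 2) (x 0) < 2 * Real.pi →
    (∀ i, IsGeodesicPath dist (x i) (x (i + 1)) (c i)) →
    (∀ i j, sphereDist (x' i) (x' j) = dist (x i) (x j)) →
    (∀ i, IsGeodesicPath sphereDist (x' i) (x' (i + 1)) (c' i)) →
    ∀ i j, ∀ s ∈ Set.Icc (0 : ℝ) (dist (x i) (x (i + 1))),
      ∀ t ∈ Set.Icc (0 : ℝ) (dist (x j) (x (j + 1))),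
        dist (c i s) (c j t) ≤ sphereDist (c' i s) (c' j t)

/-- Any two points are at distance less than `π / 2`. -/
def IsAdmissible (X : Type*) [MetricSpace X] : Prop :=
  ∀ w w' : X, dist w w' < Real.pi / 2

section

variable {X : Type*} [MetricSpace X]

/-- `p` is the point `a x ⊕ (1 - a) y` of some geodesic path from `x` to `y`. (In an admissible
CAT(1) space there is exactly one such point for each `a` in `[0, 1]`.) -/
def IsGeodesicComb (a : ℝ) (x y p : X) : Prop :=
  ∃ c : ℝ → X, IsGeodesicPath dist x y c ∧ p = c ((1 - a) * dist x y)

/-- Proper lower semicontinuous convex functions of `X` into `(-∞, ∞]`. -/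
structure IsGammaZero (f : X → EReal) : Prop where
  ne_bot : ∀ x, f x ≠ ⊥
  proper : ∃ x, f x ≠ ⊤
  lsc : LowerSemicontinuous f
  convex : ∀ (x y p : X) (a : ℝ), 0 < a → a < 1 → IsGeodesicComb a x y p →
    f p ≤ (a : EReal) * f x + ((1 - a : ℝ) : EReal) * f y

/-- The set of minimizers. -/
def argminSet (f : X → EReal) : Set X := {p | ∀ q, f p ≤ f q}

open Classical in
/-- The resolvent `R_f x`: the minimizer of `y ↦ f y + tan d(y, x) sin d(y, x)`. -/
noncomputable def convexResolvent (f : X → EReal) (x : X) : X :=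
  haveI : Nonempty X := ⟨x⟩
  Classical.epsilon fun z =>
    z ∈ argminSet fun y => f y + ((Real.tan (dist y x) * Real.sin (dist y x) : ℝ) : EReal)

/-- `inf_y limsup_n d(y, u n) < π / 2`. -/
def SphericallyBounded (u : ℕ → X) : Prop :=
  (⨅ y : X, limsup (fun n => ((dist y (u n) : ℝ) : EReal)) atTop) < ((Real.pi / 2 : ℝ) : EReal)

/-- `p` is a nearest point to `x` in `C`. -/
def IsMetricProjection (C : Set X) (x p : X) : Prop :=
  p ∈ C ∧ ∀ q ∈ C, dist x p ≤ dist x q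

end

/-! Everything is expressed through cosines of distances. Comparing a side of a triangle with the
opposite vertex gives `IsCAT1.sin_mul_cos_dist_le`, an inequality form of the spherical law of
cosines. Hence the penalty `1 / cos - cos` is uniformly convex along midpoints, and nested closed
convex sets meeting a fixed ball have a common point (`exists_mem_iInter_of_antitone`). This
replaces weak compactness and yields resolvents, minimizers and projections.

Write `z n` for the resolvent of `y n`. For (i), a minimizer `p` satisfies `cos d(p,y) ≤ cos d(z,y)
* cos d(p,z)`, which confines the orbit to a ball about `p`. Conversely, when `d(z n, y n)` stays
away from `π / 2`, the penalty error is divided by `lam n → ∞`, so `z n` minimizes `f`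
asymptotically; spherical boundedness then supplies a minimizer.

For (ii), let `p` be the projection of `v`. The minimizing sequence `z n` cannot stay closer to `v`
than `p` infinitely often by a fixed margin, or a minimizer closer than `p` would exist. So, up to
`ε`, each step contracts `1 - cos d(y n, p)` by the factor `1 - α n ^ 2 / 4`, and the divergence of
`∑ α n ^ 2` finishes. -/

/-! ### Geodesics and triangles on the unit sphere. -/

theorem cos_sphereDist (x y : Sphere2) :
    Real.cos (sphereDist x y) =
      inner ℝ (x : EuclideanSpace ℝ (Fin 3)) (y : EuclideanSpace ℝ (Fin 3)) := by
  have hx : ‖(x : EuclideanSpace ℝ (Fin 3))‖ = 1 := norm_eq_of_mem_sphere x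
  have hy : ‖(y : EuclideanSpace ℝ (Fin 3))‖ = 1 := norm_eq_of_mem_sphere y
  have h := abs_real_inner_le_norm (x : EuclideanSpace ℝ (Fin 3)) (y : EuclideanSpace ℝ (Fin 3))
  rw [hx, hy, one_mul, abs_le] at h
  exact Real.cos_arccos h.1 h.2

theorem Sphere2.inner_self (x : Sphere2) :
    inner ℝ (x : EuclideanSpace ℝ (Fin 3)) (x : EuclideanSpace ℝ (Fin 3)) = 1 := by
  rw [real_inner_self_eq_norm_sq, norm_eq_of_mem_sphere x, one_pow]

/-- The second clause is the equality case that comparison turns into the basic CAT(1) inequality.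
-/
theorem exists_geodesic_sphere2 (x y : Sphere2) (h : sphereDist x y < Real.pi) :
    ∃ c : ℝ → Sphere2, IsGeodesicPath sphereDist x y c ∧
      ∀ t ∈ Set.Icc (0 : ℝ) (sphereDist x y), ∀ w : Sphere2,
        Real.sin (sphereDist x y) * Real.cos (sphereDist (c t) w) =
          Real.sin (sphereDist x y - t) * Real.cos (sphereDist x w) +
            Real.sin t * Real.cos (sphereDist y w) := by
  set D := sphereDist x y with hD
  have hD0 : 0 ≤ D := Real.arccos_nonneg _
  have hxy := cos_sphereDist x y
  rw [← hD] at hxy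
  rcases hD0.eq_or_lt with h0 | hpos
  · have hxy1 : x = y := by
      rw [← h0, Real.cos_zero] at hxy
      exact Subtype.ext ((inner_eq_one_iff_of_norm_eq_one (norm_eq_of_mem_sphere x)
        (norm_eq_of_mem_sphere y)).1 hxy.symm)
    refine ⟨fun _ => x, ⟨rfl, hxy1, ?_⟩, ?_⟩
    · intro s hs t ht
      rw [← hD, ← h0, Set.Icc_self, Set.mem_singleton_iff] at hs ht
      rw [hs, ht, sub_self, abs_zero]
      nth_rw 2 [hxy1]
      rw [← hD, ← h0]
    · intro t ht w
      rw [← h0, Set.Icc_self, Set.mem_singleton_iff] at ht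
      simp [← h0, ht]
  · have hs : 0 < Real.sin D := Real.sin_pos_of_pos_of_lt_pi hpos h
    -- `e` is the unit tangent vector at `x` pointing towards `y`; the geodesic is `cos t • x + sin
    -- t • e`.
    set e : EuclideanSpace ℝ (Fin 3) := (Real.sin D)⁻¹ • ((y : EuclideanSpace ℝ (Fin 3)) -
      Real.cos D • (x : EuclideanSpace ℝ (Fin 3))) with he
    have hxx := Sphere2.inner_self x
    have hyy := Sphere2.inner_self y
    have hyx : inner ℝ (y : EuclideanSpace ℝ (Fin 3)) (x : EuclideanSpace ℝ (Fin 3)) =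
      Real.cos D := by rw [real_inner_comm, hxy]
    have hxe : inner ℝ (x : EuclideanSpace ℝ (Fin 3)) e = 0 := by
      rw [he, inner_smul_right, inner_sub_right, inner_smul_right, hxx, ← hxy]; ring
    have hex : inner ℝ e (x : EuclideanSpace ℝ (Fin 3)) = 0 := by rw [real_inner_comm, hxe]
    have hee : inner ℝ e e = 1 := by
      rw [he, inner_smul_right, inner_smul_left, inner_sub_right, inner_sub_left, inner_sub_left,
        inner_smul_right, inner_smul_left, inner_smul_left, inner_smul_right, hxx, hyy, hyx, ← hxy]
      simp only [conj_trivial]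
      have := Real.sin_sq_add_cos_sq D
      field_simp
      linear_combination -this
    have hin : ∀ s t : ℝ, inner ℝ (Real.cos s • (x : EuclideanSpace ℝ (Fin 3)) + Real.sin s • e)
        (Real.cos t • (x : EuclideanSpace ℝ (Fin 3)) + Real.sin t • e) = Real.cos (s - t) := by
      intro s t
      simp only [inner_add_left, inner_add_right, inner_smul_left, inner_smul_right, hxx, hxe, hex,
        hee, conj_trivial, Real.cos_sub]
      ring
    have hmem : ∀ t : ℝ, Real.cos t • (x : EuclideanSpace ℝ (Fin 3)) + Real.sin t • e ∈
        Metric.sphere (0 : EuclideanSpace ℝ (Fin 3)) 1 := by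
      intro t
      rw [mem_sphere_zero_iff_norm, ← sq_eq_sq₀ (norm_nonneg _) zero_le_one,
        ← real_inner_self_eq_norm_sq, hin, sub_self, Real.cos_zero, one_pow]
    refine ⟨fun t => ⟨_, hmem t⟩, ⟨?_, ?_, ?_⟩, ?_⟩
    · apply Subtype.ext; simp
    · apply Subtype.ext
      simp only [← hD, he, smul_smul, mul_inv_cancel₀ hs.ne', one_smul]
      abel
    · intro s hs' t ht'
      rw [← hD] at hs' ht'
      change Real.arccos _ = _
      rw [hin, ← Real.cos_abs, Real.arccos_cos (abs_nonneg _)]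
      rw [abs_le]
      constructor <;> linarith [hs'.1, hs'.2, ht'.1, ht'.2]
    · intro t _ w
      simp only [cos_sphereDist, he, inner_add_left, inner_smul_left, inner_sub_left, conj_trivial,
        Real.sin_sub]
      field_simp
      ring

theorem exists_comparison_triangle {a b c : ℝ} (ha : a ≤ Real.pi) (hb : b ≤ Real.pi)
    (hc : c ≤ Real.pi) (hs : a + b + c ≤ 2 * Real.pi) (h1 : a ≤ b + c) (h2 : b ≤ a + c)
    (h3 : c ≤ a + b) :
    ∃ x y z : Sphere2, sphereDist x y = a ∧ sphereDist x z = b ∧ sphereDist y z = c := by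
  have ha0 : 0 ≤ a := by linarith
  have hb0 : 0 ≤ b := by linarith
  have hc0 : 0 ≤ c := by linarith
  have hsa := Real.sin_nonneg_of_nonneg_of_le_pi ha0 ha
  have hsb := Real.sin_nonneg_of_nonneg_of_le_pi hb0 hb
  have hup : Real.cos c ≤ Real.cos (a - b) := by
    rw [← Real.cos_abs (a - b)]
    exact Real.cos_le_cos_of_nonneg_of_le_pi (abs_nonneg _) hc
      (abs_le.2 ⟨by linarith, by linarith⟩)
  have hlo : Real.cos (a + b) ≤ Real.cos c := by
    rcases le_total (a + b) Real.pi with h | h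
    · exact Real.cos_le_cos_of_nonneg_of_le_pi hc0 h h3
    · rw [← Real.cos_two_pi_sub (a + b)]
      exact Real.cos_le_cos_of_nonneg_of_le_pi hc0 (by linarith) (by linarith)
  rw [Real.cos_sub] at hup
  rw [Real.cos_add] at hlo
  -- The vertices will be `(1, 0, 0)`, `(cos a, sin a, 0)` and `(cos b, u, w)`. If `sin a = 0`, the
  -- two bounds force `cos c = cos a * cos b`, so `u = 0` works.
  obtain ⟨u, hu, hub⟩ : ∃ u : ℝ, Real.sin a * u = Real.cos c - Real.cos a * Real.cos b ∧
      u ^ 2 ≤ Real.sin b ^ 2 := by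
    rcases hsa.eq_or_lt with h | h
    · refine ⟨0, ?_, by rw [zero_pow two_ne_zero]; exact sq_nonneg _⟩
      rw [← h] at hup hlo
      linarith
    · refine ⟨(Real.cos c - Real.cos a * Real.cos b) / Real.sin a, by field_simp, ?_⟩
      apply sq_le_sq'
      · rw [le_div_iff₀ h]; linarith
      · rw [div_le_iff₀ h]; linarith
  have hsq := Real.sq_sqrt (sub_nonneg.2 hub)
  set w := Real.sqrt (Real.sin b ^ 2 - u ^ 2)
  have hA := Real.sin_sq_add_cos_sq a
  have hB := Real.sin_sq_add_cos_sq b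
  have key : ∀ p q r : ℝ, p ^ 2 + q ^ 2 + r ^ 2 = 1 →
      (!₂[p, q, r] : EuclideanSpace ℝ (Fin 3)) ∈
        Metric.sphere (0 : EuclideanSpace ℝ (Fin 3)) 1 := by
    intro p q r h
    rw [mem_sphere_zero_iff_norm, EuclideanSpace.norm_eq, Real.sqrt_eq_one]
    simpa [Fin.sum_univ_three] using h
  refine ⟨⟨_, key 1 0 0 (by norm_num)⟩, ⟨_, key (Real.cos a) (Real.sin a) 0 (by linarith)⟩,
    ⟨_, key (Real.cos b) u w (by linarith)⟩, ?_, ?_, ?_⟩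
  · simp [sphereDist, PiLp.inner_apply, Fin.sum_univ_three, Real.arccos_cos ha0 ha]
  · simp [sphereDist, PiLp.inner_apply, Fin.sum_univ_three, Real.arccos_cos hb0 hb]
  · rw [← Real.arccos_cos hc0 hc]
    simp only [sphereDist, PiLp.inner_apply, Fin.sum_univ_three]
    congr 1
    simp
    linarith

/-! ### The CAT(1) inequality in cosine form and uniform convexity of the penalty. -/

section

variable {X : Type*} [MetricSpace X]

theorem IsCAT1.sin_mul_cos_dist_le (hX : IsCAT1 X) (hadm : IsAdmissible X) {x y : X} {c : ℝ → X}
    (hc : IsGeodesicPath dist x y c) {t : ℝ} (ht : t ∈ Set.Icc (0 : ℝ) (dist x y)) (w : X) :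
    Real.sin (dist x y - t) * Real.cos (dist x w) + Real.sin t * Real.cos (dist y w) ≤
      Real.sin (dist x y) * Real.cos (dist (c t) w) := by
  have hpi := Real.pi_pos
  have h1 := hadm x y
  have h2 := hadm x w
  have h3 := hadm y w
  obtain ⟨c1, hc1⟩ := hX.exists_geodesic y w (by linarith)
  obtain ⟨c2, hc2⟩ := hX.exists_geodesic w x (by rw [dist_comm]; linarith)
  obtain ⟨x', y', w', e1, e2, e3⟩ := exists_comparison_triangle (a := dist x y) (b := dist x w)
    (c := dist y w) (by linarith) (by linarith) (by linarith) (by linarith)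
    (by linarith [dist_triangle x w y, dist_comm w y]) (dist_triangle x y w)
    (by linarith [dist_triangle y x w, dist_comm x y])
  have scomm : ∀ p q : Sphere2, sphereDist p q = sphereDist q p := fun p q => by
    rw [sphereDist, real_inner_comm]; rfl
  have sself : ∀ p : Sphere2, sphereDist p p = 0 := fun p => by
    rw [sphereDist, Sphere2.inner_self, Real.arccos_one]
  obtain ⟨d0, hd0, hf⟩ := exists_geodesic_sphere2 x' y' (by rw [e1]; linarith)
  obtain ⟨d1, hd1, -⟩ := exists_geodesic_sphere2 y' w' (by rw [e3]; linarith)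
  obtain ⟨d2, hd2, -⟩ := exists_geodesic_sphere2 w' x' (by rw [scomm, e2]; linarith)
  -- The vertex `w` is the start of the third side: hence side index `2` and parameter `0`.
  have hcmp := hX.comparison ![x, y, w] ![c, c1, c2] ![x', y', w'] ![d0, d1, d2]
    (by
      change dist x y + dist y w + dist w x < _
      rw [dist_comm w x]; linarith)
    (by intro i; fin_cases i <;> assumption)
    (by
      intro i j
      fin_cases i <;> fin_cases j <;>
        simp [sself, e1, e2, e3, scomm y' x', scomm w' x', scomm w' y', dist_comm])
    (by intro i; fin_cases i <;> assumption)
    0 2 t ht 0 ⟨le_rfl, dist_nonneg⟩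
  replace hcmp : dist (c t) (c2 0) ≤ sphereDist (d0 t) (d2 0) := hcmp
  rw [hc2.1, hd2.1] at hcmp
  have hcos := Real.cos_le_cos_of_nonneg_of_le_pi dist_nonneg (Real.arccos_le_pi _) hcmp
  have := hf t (by rwa [e1]) w'
  rw [e1, e2, e3] at this
  rw [← this]
  exact mul_le_mul_of_nonneg_left hcos
    (Real.sin_nonneg_of_nonneg_of_le_pi dist_nonneg (by linarith))

end

section

variable {X : Type*} [MetricSpace X]

theorem IsAdmissible.cos_dist_pos (hadm : IsAdmissible X) (x y : X) : 0 < Real.cos (dist x y) :=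
  Real.cos_pos_of_mem_Ioo
    ⟨by linarith [Real.pi_pos, dist_nonneg (x := x) (y := y)], hadm x y⟩

theorem IsAdmissible.sin_dist_pos (hadm : IsAdmissible X) {x y : X} (h : x ≠ y) :
    0 < Real.sin (dist x y) :=
  Real.sin_pos_of_pos_of_lt_pi (dist_pos.2 h) (by linarith [Real.pi_pos, hadm x y])

theorem IsCAT1.exists_isGeodesicComb (hX : IsCAT1 X) (hadm : IsAdmissible X) (a : ℝ) (x y : X) :
    ∃ p, IsGeodesicComb a x y p := by
  obtain ⟨c, hc⟩ := hX.exists_geodesic x y (by linarith [Real.pi_pos, hadm x y])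
  exact ⟨_, c, hc, rfl⟩

theorem IsGeodesicComb.eq_of_dist_eq_zero {a : ℝ} {x y p : X} (h : IsGeodesicComb a x y p)
    (h0 : dist x y = 0) : p = x := by
  obtain ⟨c, hc, rfl⟩ := h
  rw [h0, mul_zero, hc.1]

theorem IsGeodesicComb.dist_left {a : ℝ} (ha : a ∈ Set.Icc (0 : ℝ) 1) {x y p : X}
    (h : IsGeodesicComb a x y p) : dist x p = (1 - a) * dist x y := by
  obtain ⟨c, hc, rfl⟩ := h
  have hD := dist_nonneg (x := x) (y := y)
  have h1 : 0 ≤ (1 - a) * dist x y := mul_nonneg (by linarith [ha.2]) hD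
  have := hc.2.2 0 ⟨le_rfl, hD⟩ ((1 - a) * dist x y) ⟨h1, by nlinarith [ha.1]⟩
  rw [hc.1, zero_sub, abs_neg, abs_of_nonneg h1] at this
  exact this

theorem IsGeodesicComb.sin_mul_cos_dist_le (hX : IsCAT1 X) (hadm : IsAdmissible X) {a : ℝ}
    (ha : a ∈ Set.Icc (0 : ℝ) 1) {x y p : X} (h : IsGeodesicComb a x y p) (w : X) :
    Real.sin (a * dist x y) * Real.cos (dist x w) +
      Real.sin ((1 - a) * dist x y) * Real.cos (dist y w) ≤
      Real.sin (dist x y) * Real.cos (dist p w) := by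
  obtain ⟨c, hc, rfl⟩ := h
  have hD := dist_nonneg (x := x) (y := y)
  have := hX.sin_mul_cos_dist_le hadm hc (t := (1 - a) * dist x y)
    ⟨mul_nonneg (by linarith [ha.2]) hD, by nlinarith [ha.1]⟩ w
  rwa [show dist x y - (1 - a) * dist x y = a * dist x y by ring] at this

/-- Closed balls are convex. -/
theorem IsGeodesicComb.le_cos_dist (hX : IsCAT1 X) (hadm : IsAdmissible X) {a : ℝ}
    (ha : a ∈ Set.Icc (0 : ℝ) 1) {x y p : X} (h : IsGeodesicComb a x y p) {w : X} {k : ℝ}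
    (hk : 0 ≤ k) (hx : k ≤ Real.cos (dist x w)) (hy : k ≤ Real.cos (dist y w)) :
    k ≤ Real.cos (dist p w) := by
  rcases eq_or_ne x y with rfl | hne
  · rwa [h.eq_of_dist_eq_zero (dist_self _)]
  have hD := dist_nonneg (x := x) (y := y)
  have hs := hadm.sin_dist_pos hne
  have key := h.sin_mul_cos_dist_le hX hadm ha w
  have hpi := hadm x y
  have h1a : a * dist x y ≤ dist x y := mul_le_of_le_one_left hD ha.2
  have h1b : (1 - a) * dist x y ≤ dist x y := mul_le_of_le_one_left hD (by linarith [ha.1])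
  have h0a : 0 ≤ a * dist x y := mul_nonneg ha.1 hD
  have h0b : 0 ≤ (1 - a) * dist x y := mul_nonneg (by linarith [ha.2]) hD
  have s1 := Real.sin_nonneg_of_nonneg_of_le_pi h0a (by linarith [Real.pi_pos])
  have s2 := Real.sin_nonneg_of_nonneg_of_le_pi h0b (by linarith [Real.pi_pos])
  -- The two weights sum to at least `sin d(x,y)`; this helps because `k ≥ 0`.
  have hadd : Real.sin (dist x y) ≤ Real.sin (a * dist x y) + Real.sin ((1 - a) * dist x y) := by
    rw [show dist x y = a * dist x y + (1 - a) * dist x y by ring, Real.sin_add,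
      ← show dist x y = a * dist x y + (1 - a) * dist x y by ring]
    exact add_le_add (mul_le_of_le_one_right s1 (Real.cos_le_one _))
      (mul_le_of_le_one_left s2 (Real.cos_le_one _))
  have e1 := mul_le_mul_of_nonneg_left hx s1
  have e2 := mul_le_mul_of_nonneg_left hy s2
  have e3 := mul_le_mul_of_nonneg_right hadd hk
  refine le_of_mul_le_mul_left ?_ hs
  linarith

theorem IsGeodesicComb.cos_add_cos_le (hX : IsCAT1 X) (hadm : IsAdmissible X) {x y p : X}
    (h : IsGeodesicComb (1 / 2) x y p) (w : X) :
    Real.cos (dist x w) + Real.cos (dist y w) ≤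
      2 * Real.cos (dist x y / 2) * Real.cos (dist p w) := by
  rcases eq_or_ne x y with rfl | hne
  · rw [h.eq_of_dist_eq_zero (dist_self _), dist_self, zero_div, Real.cos_zero]
    linarith
  have key := h.sin_mul_cos_dist_le hX hadm ⟨by norm_num, by norm_num⟩ w
  have hpos := dist_pos.2 hne
  have hs : 0 < Real.sin (dist x y / 2) :=
    Real.sin_pos_of_pos_of_lt_pi (by linarith) (by linarith [Real.pi_pos, hadm x y])
  rw [show 1 / 2 * dist x y = dist x y / 2 by ring,
    show (1 - 1 / 2) * dist x y = dist x y / 2 by ring,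
    show Real.sin (dist x y) = 2 * Real.sin (dist x y / 2) * Real.cos (dist x y / 2) by
      rw [← Real.sin_two_mul]; congr 1; ring] at key
  refine le_of_mul_le_mul_left ?_ hs
  linarith

/-- The penalty in the definition of the resolvent. -/
noncomputable def tanSin (t : ℝ) : ℝ := Real.tan t * Real.sin t

theorem tanSin_eq {t : ℝ} (h : Real.cos t ≠ 0) : tanSin t = 1 / Real.cos t - Real.cos t := by
  rw [tanSin, Real.tan_eq_sin_div_cos]
  have := Real.sin_sq_add_cos_sq t
  field_simp
  linarith

theorem IsAdmissible.tanSin_dist_eq (hadm : IsAdmissible X) (x y : X) :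
    tanSin (dist x y) = 1 / Real.cos (dist x y) - Real.cos (dist x y) :=
  tanSin_eq (hadm.cos_dist_pos x y).ne'

theorem IsAdmissible.tanSin_dist_nonneg (hadm : IsAdmissible X) (x y : X) :
    0 ≤ tanSin (dist x y) := by
  rw [hadm.tanSin_dist_eq]
  have h := hadm.cos_dist_pos x y
  have h1 := Real.cos_le_one (dist x y)
  have := one_le_one_div h h1
  linarith

theorem IsAdmissible.tanSin_dist_le_iff (hadm : IsAdmissible X) (x y x' y' : X) :
    tanSin (dist x y) ≤ tanSin (dist x' y') ↔ Real.cos (dist x' y') ≤ Real.cos (dist x y) := by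
  rw [hadm.tanSin_dist_eq, hadm.tanSin_dist_eq]
  have h := hadm.cos_dist_pos x y
  have h' := hadm.cos_dist_pos x' y'
  constructor
  · intro H
    by_contra! hlt
    have := one_div_lt_one_div_of_lt h hlt
    linarith
  · intro H
    have := one_div_le_one_div_of_le h' H
    linarith

/-- With `A` the mean of `u₁` and `u₂`, the hypothesis gives `1 / u ≤ c / A`. The gain `1 - c`
appears because `A ≤ 1`, and `1 / A` is handled by convexity of the reciprocal. -/
theorem one_div_sub_self_le {u u₁ u₂ c : ℝ} (h₁ : 0 < u₁) (h₂ : 0 < u₂) (h₁' : u₁ ≤ 1)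
    (h₂' : u₂ ≤ 1) (hu : 0 < u) (hc1 : c ≤ 1) (h : u₁ + u₂ ≤ 2 * c * u) :
    1 / u - u ≤ ((1 / u₁ - u₁) + (1 / u₂ - u₂)) / 2 - (1 - c) := by
  set A := (u₁ + u₂) / 2 with hA
  have hA0 : 0 < A := by positivity
  have hA1 : A ≤ 1 := by rw [hA]; linarith
  have hAu : A ≤ c * u := by rw [hA]; linarith
  have e1 : 1 / u ≤ c / A := by
    rw [div_le_div_iff₀ hu hA0]; linarith
  have e2 : A ≤ u := hAu.trans (mul_le_of_le_one_left hu.le hc1)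
  have e3 : c / A ≤ 1 / A - (1 - c) := by
    have : (1 - c) * 1 ≤ (1 - c) * (1 / A) :=
      mul_le_mul_of_nonneg_left (one_le_one_div hA0 hA1) (by linarith)
    have h3 : c / A = 1 / A - (1 - c) * (1 / A) := by ring
    linarith
  have e4 : 1 / A ≤ (1 / u₁ + 1 / u₂) / 2 := by
    rw [hA, div_add_div _ _ h₁.ne' h₂.ne', div_div, div_le_div_iff₀ (by positivity) (by positivity)]
    nlinarith [sq_nonneg (u₁ - u₂)]
  linarith

/-- The gain does not depend on `w`; by `IsAdmissible.sq_dist_le` it controls `dist x y ^ 2`, so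
almost minimizing sequences are Cauchy. -/
theorem IsGeodesicComb.tanSin_dist_le (hX : IsCAT1 X) (hadm : IsAdmissible X) {x y p : X}
    (h : IsGeodesicComb (1 / 2) x y p) (w : X) :
    tanSin (dist p w) ≤ (tanSin (dist x w) + tanSin (dist y w)) / 2 -
      (1 - Real.cos (dist x y / 2)) := by
  rw [hadm.tanSin_dist_eq, hadm.tanSin_dist_eq, hadm.tanSin_dist_eq]
  exact one_div_sub_self_le (hadm.cos_dist_pos _ _) (hadm.cos_dist_pos _ _) (Real.cos_le_one _)
    (Real.cos_le_one _) (hadm.cos_dist_pos _ _) (Real.cos_le_one _) (h.cos_add_cos_le hX hadm w)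

theorem IsAdmissible.sq_dist_le (hadm : IsAdmissible X) (x y : X) :
    dist x y ^ 2 ≤ 2 * Real.pi ^ 2 * (1 - Real.cos (dist x y / 2)) := by
  have h0 := dist_nonneg (x := x) (y := y)
  have hp := Real.pi_pos
  have h := Real.cos_le_one_sub_mul_cos_sq (x := dist x y / 2)
    (by rw [abs_of_nonneg (by linarith)]; linarith [hadm x y])
  have h2 : 2 / Real.pi ^ 2 * (dist x y / 2) ^ 2 ≤ 1 - Real.cos (dist x y / 2) := by linarith
  rw [div_mul_eq_mul_div, div_le_iff₀ (by positivity)] at h2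
  linarith

/-! ### Nested closed convex sets. -/

/-- A set containing all midpoints of its pairs of points. -/
def IsMidpointConvex (C : Set X) : Prop :=
  ∀ x ∈ C, ∀ y ∈ C, ∀ p, IsGeodesicComb (1 / 2) x y p → p ∈ C

theorem IsMidpointConvex.inter {C D : Set X} (hC : IsMidpointConvex C) (hD : IsMidpointConvex D) :
    IsMidpointConvex (C ∩ D) := fun x hx y hy p hp =>
  ⟨hC x hx.1 y hy.1 p hp, hD x hx.2 y hy.2 p hp⟩

theorem isMidpointConvex_le_cos_dist (hX : IsCAT1 X) (hadm : IsAdmissible X) (w : X) {k : ℝ}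
    (hk : 0 ≤ k) : IsMidpointConvex {x | k ≤ Real.cos (dist x w)} := fun _ hx _ hy _ hp =>
  hp.le_cos_dist hX hadm ⟨by norm_num, by norm_num⟩ hk hx hy

theorem isClosed_le_cos_dist (w : X) (k : ℝ) : IsClosed {x | k ≤ Real.cos (dist x w)} :=
  isClosed_le continuous_const (Real.continuous_cos.comp (continuous_id.dist continuous_const))

/-- A decreasing sequence of closed convex sets that all meet a fixed ball of radius less than
`π / 2` has a common point. -/
theorem exists_mem_iInter_of_antitone [CompleteSpace X] (hX : IsCAT1 X) (hadm : IsAdmissible X)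
    {C : ℕ → Set X} (hanti : Antitone C) (hclosed : ∀ n, IsClosed (C n))
    (hconv : ∀ n, IsMidpointConvex (C n)) (q : X) {k : ℝ} (hk : 0 < k)
    (hmeet : ∀ n, ∃ x ∈ C n, k ≤ Real.cos (dist x q)) : ∃ x, ∀ n, x ∈ C n := by
  let S : ℕ → Set ℝ := fun n => (fun x => tanSin (dist x q)) '' C n
  have hbdd : ∀ n, BddBelow (S n) := fun n => ⟨0, by
    rintro _ ⟨x, -, rfl⟩; exact hadm.tanSin_dist_nonneg x q⟩
  have hne : ∀ n, (S n).Nonempty := fun n => by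
    obtain ⟨x, hx, -⟩ := hmeet n
    exact ⟨_, x, hx, rfl⟩
  have hle : ∀ n, ∀ x ∈ C n, sInf (S n) ≤ tanSin (dist x q) := fun n x hx =>
    csInf_le (hbdd n) ⟨x, hx, rfl⟩
  have hmono : Monotone fun n => sInf (S n) := fun m n hmn =>
    csInf_le_csInf (hbdd m) (hne n) (Set.image_mono (hanti hmn))
  have hub : BddAbove (Set.range fun n => sInf (S n)) := by
    refine ⟨1 / k, ?_⟩
    rintro _ ⟨n, rfl⟩
    obtain ⟨x, hx, hkx⟩ := hmeet n
    refine (hle n x hx).trans ?_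
    rw [hadm.tanSin_dist_eq]
    have := one_div_le_one_div_of_le hk hkx
    linarith [hadm.cos_dist_pos x q]
  have hlim := tendsto_atTop_ciSup hmono hub
  set s := ⨆ n, sInf (S n)
  have hsle : ∀ n, sInf (S n) ≤ s := fun n => le_ciSup hub n
  have hex : ∀ n, ∃ x ∈ C n, tanSin (dist x q) < sInf (S n) + 1 / ((n : ℝ) + 1) := by
    intro n
    obtain ⟨_, ⟨x, hx, rfl⟩, hlt⟩ := Real.lt_sInf_add_pos (hne n)
      (ε := 1 / ((n : ℝ) + 1)) (by positivity)
    exact ⟨x, hx, hlt⟩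
  choose u huC hu using hex
  -- Both points lie in `C n`, hence so does their midpoint, whose penalty is at least `sInf (S n)`;
  -- uniform convexity bounds their distance.
  have hdist : ∀ n m, n ≤ m → dist (u n) (u m) ^ 2 ≤
      2 * Real.pi ^ 2 * (s - sInf (S n) + 1 / ((n : ℝ) + 1)) := by
    intro n m hnm
    obtain ⟨p, hp⟩ := hX.exists_isGeodesicComb hadm (1 / 2) (u n) (u m)
    have h1 := hp.tanSin_dist_le hX hadm q
    have h2 := hle n p (hconv n _ (huC n) _ (hanti hnm (huC m)) p hp)
    have h3 : 1 / ((m : ℝ) + 1) ≤ 1 / ((n : ℝ) + 1) := by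
      apply one_div_le_one_div_of_le (by positivity)
      have : (n : ℝ) ≤ m := by exact_mod_cast hnm
      linarith
    refine (hadm.sq_dist_le _ _).trans (mul_le_mul_of_nonneg_left ?_ (by positivity))
    linarith [hu n, hu m, hsle n, hsle m]
  have hcauchy : CauchySeq u := by
    refine cauchySeq_of_le_tendsto_0' (fun n : ℕ => Real.sqrt (2 * Real.pi ^ 2 *
      (s - sInf (S n) + 1 / ((n : ℝ) + 1)))) (fun n m hnm => Real.le_sqrt_of_sq_le (hdist n m hnm)) ?_
    rw [← Real.sqrt_zero]
    apply (Real.continuous_sqrt.tendsto 0).comp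
    have h := ((tendsto_const_nhds (x := s)).sub hlim).add
      (tendsto_one_div_add_atTop_nhds_zero_nat (𝕜 := ℝ))
    simpa using h.const_mul (2 * Real.pi ^ 2)
  obtain ⟨x, hx⟩ := cauchySeq_tendsto_of_complete hcauchy
  refine ⟨x, fun n => (hclosed n).mem_of_tendsto hx ?_⟩
  filter_upwards [eventually_ge_atTop n] with m hm using hanti hm (huC m)

end

/-! ### Convex functions: lower bounds, minimizers and resolvents. -/

section

theorem EReal.coe_mul_le_coe_iff {l A : ℝ} (hl : 0 < l) (x : EReal) :
    (l : EReal) * x ≤ (A : EReal) ↔ x ≤ ((A / l : ℝ) : EReal) := by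
  induction x with
  | bot => simp [EReal.coe_mul_bot_of_pos hl]
  | coe x =>
    rw [← EReal.coe_mul, EReal.coe_le_coe_iff, EReal.coe_le_coe_iff, le_div_iff₀ hl, mul_comm]
  | top => simp [EReal.coe_mul_top_of_pos hl]

theorem EReal.add_coe_le_coe_iff {A B : ℝ} (x : EReal) :
    x + (B : EReal) ≤ (A : EReal) ↔ x ≤ ((A - B : ℝ) : EReal) := by
  induction x with
  | bot => simp
  | coe x =>
    rw [← EReal.coe_add, EReal.coe_le_coe_iff, EReal.coe_le_coe_iff]
    exact _root_.le_sub_iff_add_le.symm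
  | top => simp [-EReal.coe_sub]

variable {X : Type*} [MetricSpace X] {f : X → EReal}

theorem IsGammaZero.exists_eq_coe (hf : IsGammaZero f) {x : X} {A : ℝ} (h : f x ≤ (A : EReal)) :
    ∃ F : ℝ, f x = (F : EReal) :=
  ⟨(f x).toReal, (EReal.coe_toReal (h.trans_lt (EReal.coe_lt_top A)).ne (hf.ne_bot x)).symm⟩

theorem IsGammaZero.exists_le_coe (hf : IsGammaZero f) : ∃ (x : X) (A : ℝ), f x ≤ (A : EReal) := by
  obtain ⟨x, hx⟩ := hf.proper
  exact ⟨x, (f x).toReal, EReal.le_coe_toReal hx⟩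

theorem IsGammaZero.le_comb (hf : IsGammaZero f) {x y p : X} {a A B : ℝ} (ha : 0 < a) (ha1 : a < 1)
    (hp : IsGeodesicComb a x y p) (hx : f x ≤ (A : EReal)) (hy : f y ≤ (B : EReal)) :
    f p ≤ ((a * A + (1 - a) * B : ℝ) : EReal) := by
  refine (hf.convex x y p a ha ha1 hp).trans ?_
  rw [EReal.coe_add, EReal.coe_mul, EReal.coe_mul]
  exact add_le_add (mul_le_mul_of_nonneg_left hx (EReal.coe_nonneg.2 ha.le))
    (mul_le_mul_of_nonneg_left hy (EReal.coe_nonneg.2 (by linarith)))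

theorem IsGammaZero.const_mul (hf : IsGammaZero f) {l : ℝ} (hl : 0 < l) :
    IsGammaZero fun x => (l : EReal) * f x where
  ne_bot x := by
    have := hf.ne_bot x
    induction h : f x with
    | bot => exact absurd h this
    | coe r => rw [← EReal.coe_mul]; exact EReal.coe_ne_bot _
    | top => rw [EReal.coe_mul_top_of_pos hl]; exact top_ne_bot
  proper := by
    obtain ⟨x, A, hx⟩ := hf.exists_le_coe
    obtain ⟨F, hF⟩ := hf.exists_eq_coe hx
    refine ⟨x, ?_⟩
    rw [hF, ← EReal.coe_mul]
    exact EReal.coe_ne_top _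
  lsc := by
    rw [lowerSemicontinuous_iff_isClosed_preimage]
    have key : ∀ A : ℝ, IsClosed {x | (l : EReal) * f x ≤ (A : EReal)} := fun A => by
      simp only [EReal.coe_mul_le_coe_iff hl]
      exact hf.lsc.isClosed_preimage _
    intro b
    induction b with
    | bot =>
      have : (fun x => (l : EReal) * f x) ⁻¹' Set.Iic ⊥ =
          ⋂ A : ℝ, {x | (l : EReal) * f x ≤ (A : EReal)} := by
        ext x
        simp only [Set.mem_preimage, Set.mem_Iic, le_bot_iff, Set.mem_iInter, Set.mem_ofPred_eq]
        rw [EReal.eq_bot_iff_forall_lt]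
        exact ⟨fun h A => (h A).le, fun h A =>
          (h (A - 1)).trans_lt (EReal.coe_lt_coe_iff.2 (by linarith))⟩
      rw [this]
      exact isClosed_iInter key
    | coe A => exact key A
    | top => simp
  convex x y p a ha ha1 hp := by
    -- Infinite values are split off because `⊤` absorbs a summand only when that summand is not
    -- `⊥`.
    by_cases hx : f x = ⊤
    · have hy : ((1 - a : ℝ) : EReal) * ((l : EReal) * f y) ≠ ⊥ := by
        rw [← mul_assoc, ← EReal.coe_mul]
        have := hf.ne_bot y
        have h2 : 0 < (1 - a) * l := mul_pos (by linarith) hl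
        induction h : f y with
        | bot => exact absurd h this
        | coe r => rw [← EReal.coe_mul]; exact EReal.coe_ne_bot _
        | top => rw [EReal.coe_mul_top_of_pos h2]; exact top_ne_bot
      rw [hx, EReal.coe_mul_top_of_pos hl, EReal.coe_mul_top_of_pos ha, EReal.top_add_of_ne_bot hy]
      exact le_top
    by_cases hy : f y = ⊤
    · have hx' : (a : EReal) * ((l : EReal) * f x) ≠ ⊥ := by
        obtain ⟨F, hF⟩ := hf.exists_eq_coe (EReal.le_coe_toReal hx)
        rw [hF, ← EReal.coe_mul, ← EReal.coe_mul]
        exact EReal.coe_ne_bot _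
      rw [hy, EReal.coe_mul_top_of_pos hl, EReal.coe_mul_top_of_pos (by linarith : 0 < 1 - a),
        EReal.add_top_of_ne_bot hx']
      exact le_top
    obtain ⟨F, hF⟩ := hf.exists_eq_coe (EReal.le_coe_toReal hx)
    obtain ⟨G, hG⟩ := hf.exists_eq_coe (EReal.le_coe_toReal hy)
    have h := hf.le_comb ha ha1 hp hF.le hG.le
    rw [hF, hG, ← EReal.coe_mul, ← EReal.coe_mul, ← EReal.coe_mul, ← EReal.coe_mul,
      ← EReal.coe_add, EReal.coe_mul_le_coe_iff hl]
    refine h.trans (EReal.coe_le_coe_iff.2 (le_of_eq ?_))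
    field_simp

theorem IsGammaZero.isClosed_le (hf : IsGammaZero f) (A : EReal) : IsClosed {x | f x ≤ A} :=
  hf.lsc.isClosed_preimage A

theorem IsGammaZero.isMidpointConvex_le (hf : IsGammaZero f) (A : ℝ) :
    IsMidpointConvex {x | f x ≤ (A : EReal)} := fun x hx y hy p hp => by
  have := hf.le_comb (by norm_num) (by norm_num) hp hx hy
  rwa [show 1 / 2 * A + (1 - 1 / 2) * A = A by ring] at this

variable [CompleteSpace X]

/-- On the ball of radius `π / 4` about `x₀`, unboundedness would give a point with value `⊥`. By
admissibility every midpoint of `x₀` and `y` lies in that ball, so convexity carries the bound to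
all `y`. -/
theorem IsGammaZero.exists_coe_le (hf : IsGammaZero f) (hX : IsCAT1 X) (hadm : IsAdmissible X) :
    ∃ L : ℝ, ∀ x, (L : EReal) ≤ f x := by
  obtain ⟨x₀, F, hF⟩ := hf.exists_le_coe
  have hpi := Real.pi_pos
  have hk : 0 < Real.cos (Real.pi / 4) :=
    Real.cos_pos_of_mem_Ioo ⟨by linarith, by linarith⟩
  have hball : ∃ n : ℕ, ∀ x, Real.cos (Real.pi / 4) ≤ Real.cos (dist x x₀) →
      ((-(n : ℝ) : ℝ) : EReal) < f x := by
    by_contra! H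
    obtain ⟨x, hx⟩ := exists_mem_iInter_of_antitone hX hadm
      (C := fun n : ℕ => {x | f x ≤ ((-(n : ℝ) : ℝ) : EReal)})
      (fun m n hmn x hx => le_trans hx (EReal.coe_le_coe_iff.2 (by
        have : (m : ℝ) ≤ n := by exact_mod_cast hmn
        linarith)))
      (fun n => hf.isClosed_le _) (fun n => hf.isMidpointConvex_le _) x₀ hk
      (fun n => by obtain ⟨x, h1, h2⟩ := H n; exact ⟨x, h2, h1⟩)
    obtain ⟨G, hG⟩ := hf.exists_eq_coe (hx 0)
    obtain ⟨n, hn⟩ := exists_nat_gt (-G)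
    have := hx n
    simp only [Set.mem_ofPred_eq, hG, EReal.coe_le_coe_iff] at this
    linarith
  obtain ⟨n, hn⟩ := hball
  -- Chosen so that its mean with `F` is `-n`.
  refine ⟨-2 * n - F, fun y => ?_⟩
  by_contra! hy
  obtain ⟨m, hm⟩ := hX.exists_isGeodesicComb hadm (1 / 2) x₀ y
  have h1 := hf.le_comb (by norm_num) (by norm_num) hm hF hy.le
  have hd := hm.dist_left ⟨by norm_num, by norm_num⟩
  have h2 := hn m (Real.cos_le_cos_of_nonneg_of_le_pi dist_nonneg (by linarith) (by
    rw [dist_comm, hd]; linarith [hadm x₀ y]))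
  have h3 := h2.trans_le h1
  rw [EReal.coe_lt_coe_iff] at h3
  linarith

/-- A convex function with a minimizing sequence in a ball of radius less than `π / 2` has a
minimizer in this ball. -/
theorem IsGammaZero.exists_mem_argminSet (hf : IsGammaZero f) (hX : IsCAT1 X)
    (hadm : IsAdmissible X) (q : X) {k : ℝ} (hk : 0 < k)
    (h : ∀ (x : X) (A : ℝ), f x ≤ (A : EReal) → ∀ ε > 0, ∃ z,
      f z ≤ ((A + ε : ℝ) : EReal) ∧ k ≤ Real.cos (dist z q)) :
    ∃ p ∈ argminSet f, k ≤ Real.cos (dist p q) := by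
  obtain ⟨L, hL⟩ := hf.exists_coe_le hX hadm
  let S : Set ℝ := {A | ∃ x, f x ≤ (A : EReal)}
  have hne : S.Nonempty := by
    obtain ⟨x, A, hA⟩ := hf.exists_le_coe
    exact ⟨A, x, hA⟩
  have hbdd : BddBelow S := ⟨L, fun A ⟨x, hx⟩ => EReal.coe_le_coe_iff.1 ((hL x).trans hx)⟩
  obtain ⟨p, hp⟩ := exists_mem_iInter_of_antitone hX hadm
    (C := fun n : ℕ => {x | f x ≤ ((sInf S + 1 / ((n : ℝ) + 1) : ℝ) : EReal)} ∩
      {x | k ≤ Real.cos (dist x q)})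
    (fun m n hmn x hx => ⟨le_trans hx.1 (EReal.coe_le_coe_iff.2 (by
      have : (m : ℝ) ≤ n := by exact_mod_cast hmn
      have := one_div_le_one_div_of_le (show 0 < (m : ℝ) + 1 by positivity)
        (show (m : ℝ) + 1 ≤ n + 1 by linarith)
      linarith)), hx.2⟩)
    (fun n => (hf.isClosed_le _).inter (isClosed_le_cos_dist _ _))
    (fun n => (hf.isMidpointConvex_le _).inter (isMidpointConvex_le_cos_dist hX hadm _ hk.le))
    q hk
    (fun n => by
      obtain ⟨A, ⟨x, hx⟩, hA⟩ := Real.lt_sInf_add_pos hne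
        (ε := 1 / ((n : ℝ) + 1) / 2) (by positivity)
      obtain ⟨z, hz, hzk⟩ := h x A hx (1 / ((n : ℝ) + 1) / 2) (by positivity)
      exact ⟨z, ⟨hz.trans (EReal.coe_le_coe_iff.2 (by linarith)), hzk⟩, hzk⟩)
  refine ⟨p, fun y => ?_, (hp 0).2⟩
  by_cases hy : f y = ⊤
  · rw [hy]; exact le_top
  obtain ⟨G, hG⟩ := hf.exists_eq_coe (EReal.le_coe_toReal hy)
  obtain ⟨F, hF⟩ := hf.exists_eq_coe (hp 0).1
  rw [hG, hF, EReal.coe_le_coe_iff]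
  have hSG : sInf S ≤ G := csInf_le hbdd ⟨y, hG.le⟩
  refine le_trans ?_ hSG
  have hlim := (tendsto_const_nhds (x := sInf S)).add
    (tendsto_one_div_add_atTop_nhds_zero_nat (𝕜 := ℝ))
  rw [add_zero] at hlim
  refine ge_of_tendsto' hlim fun n => ?_
  have := (hp n).1
  rwa [Set.mem_ofPred_eq, hF, EReal.coe_le_coe_iff] at this

theorem IsAdmissible.continuous_tanSin_dist {X : Type*} [MetricSpace X] (hadm : IsAdmissible X)
    (x : X) : Continuous fun y => tanSin (dist y x) := by
  simp only [hadm.tanSin_dist_eq]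
  have h : Continuous fun y => Real.cos (dist y x) :=
    Real.continuous_cos.comp (continuous_id.dist continuous_const)
  exact (continuous_const.div h fun y => (hadm.cos_dist_pos y x).ne').sub h

theorem IsGammaZero.exists_mem_argminSet_add_tanSin (hf : IsGammaZero f) (hX : IsCAT1 X)
    (hadm : IsAdmissible X) (x : X) :
    ∃ z, z ∈ argminSet fun y => f y + ((tanSin (dist y x) : ℝ) : EReal) := by
  obtain ⟨L, hL⟩ := hf.exists_coe_le hX hadm
  let S : Set ℝ := {A | ∃ y, f y ≤ ((A - tanSin (dist y x) : ℝ) : EReal)}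
  have hne : S.Nonempty := by
    obtain ⟨y, A, hA⟩ := hf.exists_le_coe
    exact ⟨A + tanSin (dist y x), y, by rwa [add_sub_cancel_right]⟩
  have hle : ∀ y (A : ℝ), f y ≤ ((A - tanSin (dist y x) : ℝ) : EReal) →
      L + tanSin (dist y x) ≤ A := fun y A h => by
    have := EReal.coe_le_coe_iff.1 ((hL y).trans h)
    linarith
  have hbdd : BddBelow S := ⟨L, fun A ⟨y, hy⟩ => by
    linarith [hle y A hy, hadm.tanSin_dist_nonneg y x]⟩
  have hlsc : LowerSemicontinuous fun y => f y + ((tanSin (dist y x) : ℝ) : EReal) := by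
    refine hf.lsc.add' ((continuous_coe_real_ereal.comp
      (hadm.continuous_tanSin_dist x)).lowerSemicontinuous) fun y => ?_
    exact EReal.continuousAt_add (Or.inr (EReal.coe_ne_bot _)) (Or.inr (EReal.coe_ne_top _))
  -- Since `f ≥ L`, near-minimizers have bounded penalty, hence stay in a ball of radius less than
  -- `π / 2`.
  have hM : ∀ y, tanSin (dist y x) ≤ sInf S + 1 - L →
      1 / (|sInf S + 1 - L| + 1) ≤ Real.cos (dist y x) := fun y hy => by
    rw [hadm.tanSin_dist_eq] at hy
    have hc := hadm.cos_dist_pos y x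
    have h1 : 1 / Real.cos (dist y x) ≤ |sInf S + 1 - L| + 1 := by
      linarith [le_abs_self (sInf S + 1 - L), Real.cos_le_one (dist y x)]
    rw [one_div_le (by positivity) hc]
    exact h1
  obtain ⟨z, hz⟩ := exists_mem_iInter_of_antitone hX hadm
    (C := fun n : ℕ => {y | f y ≤
      ((sInf S + 1 / ((n : ℝ) + 1) - tanSin (dist y x) : ℝ) : EReal)})
    (fun m n hmn y hy => le_trans hy (EReal.coe_le_coe_iff.2 (by
      have : (m : ℝ) ≤ n := by exact_mod_cast hmn
      have := one_div_le_one_div_of_le (show 0 < (m : ℝ) + 1 by positivity)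
        (show (m : ℝ) + 1 ≤ n + 1 by linarith)
      linarith)))
    (fun n => by
      simp only [← EReal.add_coe_le_coe_iff]
      exact hlsc.isClosed_preimage _)
    (fun n y hy y' hy' p hp => by
      refine (hf.le_comb (by norm_num) (by norm_num) hp hy hy').trans
        (EReal.coe_le_coe_iff.2 ?_)
      have := hp.tanSin_dist_le hX hadm x
      linarith [Real.cos_le_one (dist y y' / 2)])
    x (k := 1 / (|sInf S + 1 - L| + 1)) (by positivity)
    (fun n => by
      obtain ⟨A, ⟨y, hy⟩, hA⟩ := Real.lt_sInf_add_pos hne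
        (ε := 1 / ((n : ℝ) + 1)) (by positivity)
      refine ⟨y, hy.trans (EReal.coe_le_coe_iff.2 (by linarith)), hM y ?_⟩
      have h1 : 1 / ((n : ℝ) + 1) ≤ 1 := by
        rw [div_le_one (by positivity)]
        linarith [n.cast_nonneg (α := ℝ)]
      linarith [hle y A hy])
  refine ⟨z, fun y => ?_⟩
  by_cases hy : f y = ⊤
  · simp only [hy, EReal.top_add_coe]; exact le_top
  obtain ⟨G, hG⟩ := hf.exists_eq_coe (EReal.le_coe_toReal hy)
  obtain ⟨F, hF⟩ := hf.exists_eq_coe (hz 0)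
  simp only [hG, hF]
  rw [← EReal.coe_add, ← EReal.coe_add, EReal.coe_le_coe_iff]
  have hSG : sInf S ≤ G + tanSin (dist y x) := csInf_le hbdd ⟨y, by
    rw [add_sub_cancel_right]; exact hG.le⟩
  refine le_trans ?_ hSG
  have hlim := (tendsto_const_nhds (x := sInf S)).add
    (tendsto_one_div_add_atTop_nhds_zero_nat (𝕜 := ℝ))
  rw [add_zero] at hlim
  refine ge_of_tendsto' hlim fun n => ?_
  have := hz n
  rw [Set.mem_ofPred_eq, hF, EReal.coe_le_coe_iff] at this
  linarith

theorem IsGammaZero.convexResolvent_mem (hf : IsGammaZero f) (hX : IsCAT1 X)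
    (hadm : IsAdmissible X) (x : X) :
    convexResolvent f x ∈ argminSet fun y => f y + ((tanSin (dist y x) : ℝ) : EReal) :=
  Classical.epsilon_spec (hf.exists_mem_argminSet_add_tanSin hX hadm x)

theorem IsGammaZero.convexResolvent_le (hf : IsGammaZero f) (hX : IsCAT1 X)
    (hadm : IsAdmissible X) (x w : X) {A : ℝ} (hw : f w ≤ (A : EReal)) :
    f (convexResolvent f x) ≤
      ((A + tanSin (dist w x) - tanSin (dist (convexResolvent f x) x) : ℝ) : EReal) := by
  rw [← EReal.add_coe_le_coe_iff, EReal.coe_add]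
  exact (hf.convexResolvent_mem hX hadm x w).trans (add_le_add hw le_rfl)

/-- Testing minimality at `p` itself would involve `d(p,x)`, which may be near `π / 2`. The midpoint
`m` of `p` and the resolvent `z` satisfies `cos d(m,x) ≥ cos d(z,x) / 2`, so the error does not
depend on `p`. -/
theorem IsGammaZero.convexResolvent_le_add (hf : IsGammaZero f) (hX : IsCAT1 X)
    (hadm : IsAdmissible X) (x p : X) {A : ℝ} (hp : f p ≤ (A : EReal)) :
    f (convexResolvent f x) ≤
      ((A + 4 / Real.cos (dist (convexResolvent f x) x) : ℝ) : EReal) := by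
  have hle := fun w B h => hf.convexResolvent_le hX hadm x w (A := B) h
  set z := convexResolvent f x
  obtain ⟨Z, hZ⟩ := hf.exists_eq_coe (hle p A hp)
  obtain ⟨m, hm⟩ := hX.exists_isGeodesicComb hadm (1 / 2) p z
  have h1 := hle m _ (hf.le_comb (by norm_num) (by norm_num) hm hp hZ.le)
  rw [hZ, EReal.coe_le_coe_iff] at h1 ⊢
  have hC := hadm.cos_dist_pos z x
  have hm0 := hadm.cos_dist_pos m x
  have h2 : Real.cos (dist z x) ≤ 2 * Real.cos (dist m x) := by
    have e1 := hm.cos_add_cos_le hX hadm x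
    have e2 := mul_le_of_le_one_left hm0.le (Real.cos_le_one (dist p z / 2))
    linarith [hadm.cos_dist_pos p x]
  have h3 : tanSin (dist m x) ≤ 2 / Real.cos (dist z x) := by
    have : 1 / Real.cos (dist m x) ≤ 2 / Real.cos (dist z x) := by
      rw [div_le_div_iff₀ hm0 hC]; linarith
    rw [hadm.tanSin_dist_eq]
    linarith
  have h4 := hadm.tanSin_dist_nonneg z x
  have h5 : 4 / Real.cos (dist z x) = 2 * (2 / Real.cos (dist z x)) := by ring
  linarith

/-- Moving from `z` towards a minimizer does not raise `f`, so by minimality it cannot bring the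
point closer to `x`. The claim is the first-order form of this at `z`. -/
theorem IsGammaZero.cos_dist_le_convexResolvent (hf : IsGammaZero f) (hX : IsCAT1 X)
    (hadm : IsAdmissible X) (x : X) {p : X} (hp : p ∈ argminSet f) :
    Real.cos (dist p x) ≤
      Real.cos (dist (convexResolvent f x) x) * Real.cos (dist p (convexResolvent f x)) := by
  have hle := fun w B h => hf.convexResolvent_le hX hadm x w (A := B) h
  set z := convexResolvent f x
  rcases eq_or_ne p z with hpz | hne
  · rw [← hpz, dist_self, Real.cos_zero, mul_one]
  obtain ⟨x₀, A, hA⟩ := hf.exists_le_coe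
  obtain ⟨Z, hZ⟩ := hf.exists_eq_coe (hle x₀ A hA)
  have hpZ : f p ≤ (Z : EReal) := (hp z).trans hZ.le
  have hD := dist_pos.2 hne
  set D := dist p z with hDdef
  have hpi := Real.pi_pos
  have hDpi : D < Real.pi / 2 := hadm p z
  -- The comparison inequality at weight `t` on `p`, divided by `2 * sin (t * D / 2)` so that the
  -- limit `t → 0` is informative.
  have key : ∀ t ∈ Set.Ioo (0 : ℝ) 1,
      Real.cos (t * D / 2) * Real.cos (dist p x) ≤
        Real.cos (dist z x) * Real.cos (D - t * D / 2) := by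
    intro t ht
    obtain ⟨m, hm⟩ := hX.exists_isGeodesicComb hadm t p z
    have h1 := hle m _ (hf.le_comb ht.1 ht.2 hm hpZ hZ.le)
    rw [hZ, EReal.coe_le_coe_iff] at h1
    have h2 : Real.cos (dist m x) ≤ Real.cos (dist z x) :=
      (hadm.tanSin_dist_le_iff z x m x).1 (by linarith)
    have h3 := hm.sin_mul_cos_dist_le hX hadm ⟨ht.1.le, ht.2.le⟩ x
    rw [← hDdef] at h3
    have h4 := mul_le_mul_of_nonneg_left h2 (hadm.sin_dist_pos hne).le
    rw [← hDdef] at h4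
    have htD : t * D < D := mul_lt_of_lt_one_left hD ht.2
    have hs : 0 < Real.sin (t * D / 2) :=
      Real.sin_pos_of_pos_of_lt_pi (by have := mul_pos ht.1 hD; linarith) (by linarith)
    have e1 : Real.sin (t * D) = 2 * Real.sin (t * D / 2) * Real.cos (t * D / 2) := by
      rw [← Real.sin_two_mul]; congr 1; ring
    have e2 : Real.sin D - Real.sin ((1 - t) * D) =
        2 * Real.sin (t * D / 2) * Real.cos (D - t * D / 2) := by
      rw [Real.sin_sub_sin]
      congr 2 <;> ring_nf
    rw [e1] at h3
    refine le_of_mul_le_mul_left ?_ hs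
    have e3 : Real.cos (dist z x) * (Real.sin D - Real.sin ((1 - t) * D)) =
      Real.cos (dist z x) * (2 * Real.sin (t * D / 2) * Real.cos (D - t * D / 2)) := by rw [e2]
    linarith
  have hl : Tendsto (fun t : ℝ => Real.cos (t * D / 2) * Real.cos (dist p x)) (𝓝[>] 0)
      (𝓝 (Real.cos (dist p x))) := by
    have : Continuous fun t : ℝ => Real.cos (t * D / 2) * Real.cos (dist p x) := by fun_prop
    have h := this.tendsto 0
    simp only [zero_mul, zero_div, Real.cos_zero, one_mul] at h
    exact h.mono_left nhdsWithin_le_nhds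
  have hr : Tendsto (fun t : ℝ => Real.cos (dist z x) * Real.cos (D - t * D / 2)) (𝓝[>] 0)
      (𝓝 (Real.cos (dist z x) * Real.cos D)) := by
    have : Continuous fun t : ℝ => Real.cos (dist z x) * Real.cos (D - t * D / 2) := by fun_prop
    have h := this.tendsto 0
    simp only [zero_mul, zero_div, sub_zero] at h
    exact h.mono_left nhdsWithin_le_nhds
  refine le_of_tendsto_of_tendsto hl hr ?_
  filter_upwards [Ioo_mem_nhdsGT (show (0 : ℝ) < 1 by norm_num)] with t ht using key t ht

end

/-! ### Real estimates behind the recursion. -/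

theorem tendsto_zero_of_le_one_sub_mul {w b : ℕ → ℝ} (hw : ∀ n, 0 ≤ w n)
    (h : ∀ᶠ n in atTop, w (n + 1) ≤ (1 - b n) * w n)
    (hb : Tendsto (fun N => ∑ n ∈ Finset.range N, b n) atTop atTop) :
    Tendsto w atTop (𝓝 0) := by
  obtain ⟨N, hN⟩ := eventually_atTop.1 h
  have key : ∀ n, N ≤ n → w n ≤
      Real.exp (∑ i ∈ Finset.range N, b i - ∑ i ∈ Finset.range n, b i) * w N := by
    intro n hn
    induction n, hn using Nat.le_induction with
    | base => simp
    | succ n hn ih =>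
      have h1 : 1 - b n ≤ Real.exp (-b n) := Real.one_sub_le_exp_neg _
      rw [Finset.sum_range_succ, ← sub_sub, sub_eq_add_neg _ (b n), Real.exp_add]
      calc w (n + 1) ≤ (1 - b n) * w n := hN n hn
        _ ≤ Real.exp (-b n) * w n := mul_le_mul_of_nonneg_right h1 (hw n)
        _ ≤ Real.exp (-b n) * (Real.exp (∑ i ∈ Finset.range N, b i -
            ∑ i ∈ Finset.range n, b i) * w N) := mul_le_mul_of_nonneg_left ih (Real.exp_nonneg _)
        _ = _ := by ring
  have hlim : Tendsto (fun n => Real.exp (∑ i ∈ Finset.range N, b i -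
      ∑ i ∈ Finset.range n, b i) * w N) atTop (𝓝 0) := by
    rw [← zero_mul (w N)]
    refine (Real.tendsto_exp_atBot.comp ?_).mul_const (w N)
    simp only [sub_eq_add_neg]
    exact tendsto_atBot_add_const_left _ _ (tendsto_neg_atTop_atBot.comp hb)
  refine tendsto_of_tendsto_of_tendsto_of_le_of_le' tendsto_const_nhds hlim
    (Eventually.of_forall hw) ?_
  filter_upwards [eventually_ge_atTop N] with n hn using key n hn

/-- The difference of sines is `2 * sin (a * D / 2) * cos (D - a * D / 2)`, and chord bounds give
the two trigonometric factors at least `a * D / π` and `a / 2`. Only `a ^ 2` is available: the sine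
is flat at `D = π / 2`. -/
theorem sin_one_sub_mul_le {a D : ℝ} (ha : a ∈ Set.Icc (0 : ℝ) 1) (hD : 0 ≤ D)
    (hD' : D ≤ Real.pi / 2) :
    Real.sin ((1 - a) * D) ≤ (1 - a ^ 2 / 4) * Real.sin D := by
  have hpi := Real.pi_pos
  have haD : 0 ≤ a * D := mul_nonneg ha.1 hD
  have haD1 : a * D ≤ D := mul_le_of_le_one_left hD ha.2
  have e : Real.sin D - Real.sin ((1 - a) * D) =
      2 * Real.sin (a * D / 2) * Real.cos (D - a * D / 2) := by
    rw [Real.sin_sub_sin]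
    congr 2 <;> ring_nf
  have h1 : 2 / Real.pi * (a * D / 2) ≤ Real.sin (a * D / 2) :=
    Real.mul_le_sin (by linarith) (by linarith)
  have h2 : a / 2 ≤ Real.cos (D - a * D / 2) := by
    have := Real.one_sub_mul_le_cos (x := D - a * D / 2) (by linarith) (by linarith)
    refine le_trans ?_ this
    have h3 : D - a * D / 2 ≤ Real.pi / 2 * (1 - a / 2) := by
      have := mul_le_mul_of_nonneg_right hD' (show 0 ≤ 1 - a / 2 by linarith [ha.2])
      linarith
    have h4 : 2 / Real.pi * (D - a * D / 2) ≤ 2 / Real.pi * (Real.pi / 2 * (1 - a / 2)) :=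
      mul_le_mul_of_nonneg_left h3 (by positivity)
    have h5 : 2 / Real.pi * (Real.pi / 2 * (1 - a / 2)) = 1 - a / 2 := by field_simp
    linarith
  have h0 : 0 ≤ 2 / Real.pi * (a * D / 2) := by positivity
  have h3 := mul_le_mul h1 h2 (by linarith [ha.1]) (h0.trans h1)
  have h4 : a ^ 2 / 4 * Real.sin D ≤ 2 * (2 / Real.pi * (a * D / 2) * (a / 2)) := by
    have h5 : 2 * (2 / Real.pi * (a * D / 2) * (a / 2)) = a ^ 2 / Real.pi * D := by
      field_simp
    rw [h5]
    exact mul_le_mul (div_le_div_of_nonneg_left (sq_nonneg a) hpi Real.pi_le_four)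
      (Real.sin_le hD) (Real.sin_nonneg_of_nonneg_of_le_pi hD (by linarith)) (by positivity)
  linarith

/-! ### The Halpern step, the set of minimizers and its projection. -/

section

variable {X : Type*} [MetricSpace X]

theorem IsAdmissible.tendsto_of_tendsto_cos_dist (hadm : IsAdmissible X) {u : ℕ → X} {p : X}
    (h : Tendsto (fun n => 1 - Real.cos (dist (u n) p)) atTop (𝓝 0)) :
    Tendsto u atTop (𝓝 p) := by
  rw [tendsto_iff_dist_tendsto_zero]
  have h1 : Tendsto (fun n => Real.sqrt (Real.pi ^ 2 / 2 * (1 - Real.cos (dist (u n) p)))) atTop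
      (𝓝 0) := by
    have := (Real.continuous_sqrt.tendsto _).comp (h.const_mul (Real.pi ^ 2 / 2))
    rwa [mul_zero, Real.sqrt_zero] at this
  refine squeeze_zero (fun _ => dist_nonneg) (fun n => Real.le_sqrt_of_sq_le ?_) h1
  have hpi := Real.pi_pos
  have hq := Real.cos_le_one_sub_mul_cos_sq (x := dist (u n) p)
    (by rw [abs_of_nonneg dist_nonneg]; linarith [hadm (u n) p])
  have : dist (u n) p ^ 2 =
      Real.pi ^ 2 / 2 * (2 / Real.pi ^ 2 * dist (u n) p ^ 2) := by field_simp
  rw [this]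
  exact mul_le_mul_of_nonneg_left (by linarith) (by positivity)

/-- One step of the Halpern iteration with anchor `v`. -/
theorem IsGeodesicComb.max_sub_le (hX : IsCAT1 X) (hadm : IsAdmissible X) {a ε : ℝ}
    (ha : a ∈ Set.Icc (0 : ℝ) 1) {v z x p : X} (h : IsGeodesicComb a v z x)
    (h0 : v = z → 1 - Real.cos (dist v p) ≤ ε)
    (h1 : Real.cos (dist v z - a * dist v z / 2) * (1 - ε) ≤
      Real.cos (a * dist v z / 2) * Real.cos (dist v p)) :
    max (1 - Real.cos (dist x p) - ε) 0 ≤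
      (1 - a ^ 2 / 4) * max (1 - Real.cos (dist z p) - ε) 0 := by
  have ha2 : 0 ≤ 1 - a ^ 2 / 4 := by nlinarith [ha.1, ha.2]
  refine max_le ?_ (mul_nonneg ha2 (le_max_right _ _))
  have hM0 := le_max_right (1 - Real.cos (dist z p) - ε) 0
  have hM1 := le_max_left (1 - Real.cos (dist z p) - ε) 0
  set M := max (1 - Real.cos (dist z p) - ε) 0
  rcases eq_or_ne v z with hvz | hne
  · rw [h.eq_of_dist_eq_zero (by rw [hvz, dist_self])]
    linarith [h0 hvz, mul_nonneg ha2 hM0]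
  have hs := hadm.sin_dist_pos hne
  have hD := dist_nonneg (x := v) (y := z)
  have hD' := hadm v z
  have key := h.sin_mul_cos_dist_le hX hadm ha p
  have hsin := sin_one_sub_mul_le ha hD hD'.le
  set D := dist v z
  have hpi := Real.pi_pos
  have haD : 0 ≤ a * D := mul_nonneg ha.1 hD
  have haD1 : a * D ≤ D := mul_le_of_le_one_left hD ha.2
  have hs1 : 0 ≤ Real.sin ((1 - a) * D) :=
    Real.sin_nonneg_of_nonneg_of_le_pi (by linarith) (by linarith)
  have hs2 : 0 ≤ Real.sin (a * D / 2) :=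
    Real.sin_nonneg_of_nonneg_of_le_pi (by linarith) (by linarith)
  have e1 : Real.sin (a * D) = 2 * Real.sin (a * D / 2) * Real.cos (a * D / 2) := by
    rw [← Real.sin_two_mul]; congr 1; ring
  have e2 : Real.sin D - Real.sin ((1 - a) * D) =
      2 * Real.sin (a * D / 2) * Real.cos (D - a * D / 2) := by
    rw [Real.sin_sub_sin]
    congr 2 <;> ring_nf
  -- The share of the anchor `v` makes up for the weight lost by `z`, up to `ε`.
  have h2 : (1 - ε) * (Real.sin D - Real.sin ((1 - a) * D)) ≤
      Real.sin (a * D) * Real.cos (dist v p) := by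
    rw [e1, e2]
    have := mul_le_mul_of_nonneg_left h1 hs2
    linarith
  have h3 := mul_le_mul_of_nonneg_left hM1 hs1
  have h4 := mul_le_mul_of_nonneg_right hsin hM0
  refine le_of_mul_le_mul_left ?_ hs
  linarith

variable {f : X → EReal}

theorem mem_argminSet_const_mul {Y : Type*} {f : Y → EReal} {l : ℝ} (hl : 0 < l) {p : Y}
    (hp : p ∈ argminSet f) : p ∈ argminSet fun x => (l : EReal) * f x := fun q =>
  mul_le_mul_of_nonneg_left (hp q) (EReal.coe_nonneg.2 hl.le)

/-- The minimum is finite, so closedness and convexity follow from those of real sublevel sets. -/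
theorem IsGammaZero.exists_argminSet_eq (hf : IsGammaZero f) {p : X} (hp : p ∈ argminSet f) :
    ∃ F : ℝ, argminSet f = {x | f x ≤ (F : EReal)} := by
  obtain ⟨x, A, hA⟩ := hf.exists_le_coe
  obtain ⟨F, hF⟩ := hf.exists_eq_coe ((hp x).trans hA)
  refine ⟨F, Set.ext fun z => ⟨fun hz => (hz p).trans hF.le, fun hz q => ?_⟩⟩
  exact (le_trans hz hF.ge).trans (hp q)

theorem IsGammaZero.isClosed_argminSet (hf : IsGammaZero f) : IsClosed (argminSet f) := by
  rcases (argminSet f).eq_empty_or_nonempty with h | ⟨p, hp⟩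
  · rw [h]; exact isClosed_empty
  · obtain ⟨F, hF⟩ := hf.exists_argminSet_eq hp
    rw [hF]; exact hf.isClosed_le _

theorem IsGammaZero.isMidpointConvex_argminSet (hf : IsGammaZero f) :
    IsMidpointConvex (argminSet f) := by
  rcases (argminSet f).eq_empty_or_nonempty with h | ⟨p, hp⟩
  · rw [h]; exact fun x hx => hx.elim
  · obtain ⟨F, hF⟩ := hf.exists_argminSet_eq hp
    rw [hF]; exact hf.isMidpointConvex_le _

theorem IsMidpointConvex.eq_of_isMetricProjection (hX : IsCAT1 X) (hadm : IsAdmissible X)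
    {C : Set X} (hC : IsMidpointConvex C) {v p q : X} (hp : IsMetricProjection C v p)
    (hq : IsMetricProjection C v q) : q = p := by
  obtain ⟨m, hm⟩ := hX.exists_isGeodesicComb hadm (1 / 2) q p
  have hpi := Real.pi_pos
  have hpm := hp.2 m (hC q hq.1 p hp.1 m hm)
  have hqp : dist v q = dist v p := le_antisymm (hq.2 p hp.1) (hp.2 q hq.1)
  have h1 := hm.cos_add_cos_le hX hadm v
  rw [dist_comm q v, dist_comm p v, dist_comm m v, hqp] at h1
  have h2 : Real.cos (dist v m) ≤ Real.cos (dist v p) :=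
    Real.cos_le_cos_of_nonneg_of_le_pi dist_nonneg (by linarith [hadm v m]) hpm
  have hc := hadm.cos_dist_pos v p
  have hd : 0 ≤ Real.cos (dist q p / 2) := Real.cos_nonneg_of_mem_Icc
    ⟨by linarith [dist_nonneg (x := q) (y := p)],
      by linarith [hadm q p, dist_nonneg (x := q) (y := p)]⟩
  have h3 := mul_le_mul_of_nonneg_left h2 hd
  have h4 : 1 ≤ Real.cos (dist q p / 2) := le_of_mul_le_mul_right (by linarith) hc
  have h5 := hadm.sq_dist_le q p
  have h6 : 2 * Real.pi ^ 2 * (1 - Real.cos (dist q p / 2)) ≤ 0 :=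
    mul_nonpos_of_nonneg_of_nonpos (by positivity) (by linarith)
  exact dist_eq_zero.1 (pow_eq_zero_iff two_ne_zero |>.1
    (le_antisymm (h5.trans h6) (sq_nonneg _)))

theorem IsMidpointConvex.exists_isMetricProjection [CompleteSpace X] (hX : IsCAT1 X)
    (hadm : IsAdmissible X) {C : Set X} (hC : IsMidpointConvex C) (hcl : IsClosed C)
    (hne : C.Nonempty) (v : X) : ∃ p, IsMetricProjection C v p := by
  have hpi := Real.pi_pos
  let S : Set ℝ := (fun x => Real.cos (dist x v)) '' C
  have hS : S.Nonempty := hne.image _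
  have hbdd : BddAbove S := ⟨1, by rintro _ ⟨x, -, rfl⟩; exact Real.cos_le_one _⟩
  have hle : ∀ x ∈ C, Real.cos (dist x v) ≤ sSup S := fun x hx => le_csSup hbdd ⟨x, hx, rfl⟩
  have hK : 0 < sSup S := by
    obtain ⟨x, hx⟩ := hne
    exact (hadm.cos_dist_pos x v).trans_le (hle x hx)
  set K := sSup S
  have hfrac : ∀ n : ℕ, 1 / ((n : ℝ) + 1) ≤ 1 := fun n => by
    rw [div_le_one (by positivity)]
    linarith [n.cast_nonneg (α := ℝ)]
  -- The levels increase to `K` but never fall below `K / 2`, which fixes one ball for all `n`.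
  have hk : ∀ n : ℕ, K / 2 ≤ K - K / 2 * (1 / ((n : ℝ) + 1)) := fun n => by
    have := mul_le_mul_of_nonneg_left (hfrac n) (show 0 ≤ K / 2 by linarith)
    linarith
  obtain ⟨p, hp⟩ := exists_mem_iInter_of_antitone hX hadm
    (C := fun n : ℕ => C ∩ {x | K - K / 2 * (1 / ((n : ℝ) + 1)) ≤ Real.cos (dist x v)})
    (fun m n hmn x hx => ⟨hx.1, le_trans (b := K - K / 2 * (1 / ((n : ℝ) + 1))) (by
      have : (m : ℝ) ≤ n := by exact_mod_cast hmn
      have := one_div_le_one_div_of_le (show 0 < (m : ℝ) + 1 by positivity)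
        (show (m : ℝ) + 1 ≤ n + 1 by linarith)
      have := mul_le_mul_of_nonneg_left this (show 0 ≤ K / 2 by linarith)
      linarith) hx.2⟩)
    (fun n => hcl.inter (isClosed_le_cos_dist _ _))
    (fun n => hC.inter (isMidpointConvex_le_cos_dist hX hadm _ (by linarith [hk n])))
    v (half_pos hK)
    (fun n => by
      obtain ⟨_, ⟨x, hx, rfl⟩, hlt⟩ := exists_lt_of_lt_csSup hS
        (show K - K / 2 * (1 / ((n : ℝ) + 1)) < K by
          have : 0 < K / 2 * (1 / ((n : ℝ) + 1)) := by positivity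
          linarith)
      exact ⟨x, ⟨hx, hlt.le⟩, (hk n).trans hlt.le⟩)
  have hpK : K ≤ Real.cos (dist p v) := by
    have hlim := (tendsto_const_nhds (x := K)).sub
      ((tendsto_one_div_add_atTop_nhds_zero_nat (𝕜 := ℝ)).const_mul (K / 2))
    rw [mul_zero, sub_zero] at hlim
    exact le_of_tendsto' hlim fun n => (hp n).2
  refine ⟨p, (hp 0).1, fun q hq => ?_⟩
  by_contra! hlt
  have := Real.cos_lt_cos_of_nonneg_of_le_pi dist_nonneg (by linarith [hadm v p]) hlt
  rw [dist_comm v p, dist_comm v q] at this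
  linarith [hle q hq]

variable [CompleteSpace X]

/-- The error for `lam n * f` is at most `4 / k`; dividing by `lam n` makes it vanish. -/
theorem IsGammaZero.eventually_convexResolvent_le (hf : IsGammaZero f) (hX : IsCAT1 X)
    (hadm : IsAdmissible X) {lam : ℕ → ℝ} (hlam_pos : ∀ n, 0 < lam n)
    (hlam : Tendsto lam atTop atTop) {y : ℕ → X} {k : ℝ} (hk : 0 < k)
    (h : ∀ n, k ≤ Real.cos (dist (convexResolvent (fun x => (lam n : EReal) * f x) (y n)) (y n)))
    {x : X} {A : ℝ} (hx : f x ≤ (A : EReal)) {ε : ℝ} (hε : 0 < ε) :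
    ∀ᶠ n in atTop, f (convexResolvent (fun x => (lam n : EReal) * f x) (y n)) ≤
      ((A + ε : ℝ) : EReal) := by
  filter_upwards [hlam.eventually_ge_atTop (4 / k / ε)] with n hn
  have h1 := (hf.const_mul (hlam_pos n)).convexResolvent_le_add hX hadm (y n) x
    (A := lam n * A) (by
      rw [EReal.coe_mul_le_coe_iff (hlam_pos n), mul_div_cancel_left₀ _ (hlam_pos n).ne']
      exact hx)
  rw [EReal.coe_mul_le_coe_iff (hlam_pos n)] at h1
  refine h1.trans (EReal.coe_le_coe_iff.2 ?_)
  rw [div_le_iff₀ (hlam_pos n)]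
  have h2 := div_le_div_of_nonneg_left (show (0 : ℝ) ≤ 4 by norm_num) hk (h n)
  rw [div_le_iff₀ hε] at hn
  linarith

/-- If a minimizer exists, the iterates stay in a ball around it of radius less than `π / 2`. -/
theorem IsGammaZero.exists_le_cos_dist (hf : IsGammaZero f) (hX : IsCAT1 X)
    (hadm : IsAdmissible X) {v : X} {α lam : ℕ → ℝ} {y : ℕ → X}
    (hα : ∀ n, α n ∈ Set.Icc (0 : ℝ) 1) (hlam_pos : ∀ n, 0 < lam n)
    (hy : ∀ n, IsGeodesicComb (α n) v
      (convexResolvent (fun x => (lam n : EReal) * f x) (y n)) (y (n + 1)))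
    {p : X} (hp : p ∈ argminSet f) :
    ∃ k > 0, ∀ n,
      k ≤ Real.cos (dist p (convexResolvent (fun x => (lam n : EReal) * f x) (y n))) ∧
      k ≤ Real.cos (dist (convexResolvent (fun x => (lam n : EReal) * f x) (y n)) (y n)) := by
  have hz := fun n => (hf.const_mul (hlam_pos n)).cos_dist_le_convexResolvent hX hadm (y n)
    (mem_argminSet_const_mul (hlam_pos n) hp)
  set z := fun n => convexResolvent (fun x => (lam n : EReal) * f x) (y n)
  have hz1 : ∀ n, Real.cos (dist p (y n)) ≤ Real.cos (dist p (z n)) := fun n =>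
    (hz n).trans (mul_le_of_le_one_left (hadm.cos_dist_pos _ _).le (Real.cos_le_one _))
  have hz2 : ∀ n, Real.cos (dist p (y n)) ≤ Real.cos (dist (z n) (y n)) := fun n =>
    (hz n).trans (mul_le_of_le_one_right (hadm.cos_dist_pos _ _).le (Real.cos_le_one _))
  -- Balls about `p` are convex and resolvents do not increase the distance to `p`, so a ball
  -- containing `v` and `y 0` traps the orbit.
  set k := min (Real.cos (dist v p)) (Real.cos (dist p (y 0)))
  have hk : 0 < k := lt_min (hadm.cos_dist_pos _ _) (hadm.cos_dist_pos _ _)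
  have hyk : ∀ n, k ≤ Real.cos (dist p (y n)) := by
    intro n
    induction n with
    | zero => exact min_le_right _ _
    | succ n ih =>
      rw [dist_comm]
      exact (hy n).le_cos_dist hX hadm (hα n) hk.le (min_le_left _ _)
        (by rw [dist_comm]; exact ih.trans (hz1 n))
  exact ⟨k, hk, fun n => ⟨(hyk n).trans (hz1 n), (hyk n).trans (hz2 n)⟩⟩

theorem IsAdmissible.dist_le_arccos {X : Type*} [MetricSpace X] (hadm : IsAdmissible X) {x y : X}
    {k : ℝ} (h : k ≤ Real.cos (dist x y)) : dist x y ≤ Real.arccos k := by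
  rw [← Real.arccos_cos dist_nonneg
    (show dist x y ≤ Real.pi by linarith [Real.pi_pos, hadm x y])]
  exact Real.arccos_le_arccos h

end

/-! ### The main theorem. -/

theorem theorem5p1 {X : Type*} [MetricSpace X] [CompleteSpace X]
    (hX : IsCAT1 X) (hadm : IsAdmissible X)
    (f : X → EReal) (hf : IsGammaZero f)
    (v : X) (α lam : ℕ → ℝ) (y : ℕ → X)
    (hα : ∀ n, α n ∈ Set.Icc (0 : ℝ) 1)
    (hlam_pos : ∀ n, 0 < lam n)
    (hlam : Tendsto lam atTop atTop)
    (hy : ∀ n, IsGeodesicComb (α n) v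
      (convexResolvent (fun x => (lam n : EReal) * f x) (y n)) (y (n + 1))) :
    ((argminSet f).Nonempty ↔
      SphericallyBounded (fun n => convexResolvent (fun x => (lam n : EReal) * f x) (y n)) ∧
      (⨆ n, ((dist (convexResolvent (fun x => (lam n : EReal) * f x) (y n)) (y n) : ℝ) : EReal)) <
        ((Real.pi / 2 : ℝ) : EReal)) ∧
    ((argminSet f).Nonempty → Tendsto α atTop (𝓝 0) →
      Tendsto (fun N => ∑ n ∈ Finset.range N, α n ^ 2) atTop atTop →
      ∃ p : X, IsMetricProjection (argminSet f) v p ∧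
        (∀ q, IsMetricProjection (argminSet f) v q → q = p) ∧
        Tendsto y atTop (𝓝 p) ∧
        Tendsto (fun n => convexResolvent (fun x => (lam n : EReal) * f x) (y n)) atTop (𝓝 p)) := by
  have hpi := Real.pi_pos
  refine ⟨⟨?_, ?_⟩, ?_⟩
  · rintro ⟨p, hp⟩
    obtain ⟨k, hk, hkn⟩ := hf.exists_le_cos_dist hX hadm hα hlam_pos hy hp
    have hr : ((Real.arccos k : ℝ) : EReal) < ((Real.pi / 2 : ℝ) : EReal) :=
      EReal.coe_lt_coe_iff.2 (Real.arccos_lt_pi_div_two.2 hk)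
    refine ⟨lt_of_le_of_lt (iInf_le_of_le p (limsup_le_of_le (h := ?_))) hr,
      lt_of_le_of_lt (iSup_le fun n => ?_) hr⟩
    · exact Eventually.of_forall fun n =>
        EReal.coe_le_coe_iff.2 (hadm.dist_le_arccos (hkn n).1)
    · exact EReal.coe_le_coe_iff.2 (hadm.dist_le_arccos (hkn n).2)
  · rintro ⟨hsb, hsup⟩
    obtain ⟨q, hq⟩ := iInf_lt_iff.1 hsb
    obtain ⟨r, hr1, hr2⟩ := EReal.lt_iff_exists_real_btwn.1 hq
    obtain ⟨ρ, hρ1, hρ2⟩ := EReal.lt_iff_exists_real_btwn.1 hsup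
    rw [EReal.coe_lt_coe_iff] at hr2 hρ2
    -- Truncating at `0` keeps the cosine monotone without a sign for `s`.
    have hcos : ∀ s < Real.pi / 2, 0 < Real.cos (max s 0) ∧ ∀ x y : X, dist x y ≤ s →
        Real.cos (max s 0) ≤ Real.cos (dist x y) := fun s hs => by
      have h0 := le_max_right s 0
      have h1 : max s 0 < Real.pi / 2 := max_lt hs (by linarith)
      exact ⟨Real.cos_pos_of_mem_Ioo ⟨by linarith, h1⟩, fun x y hxy =>
        Real.cos_le_cos_of_nonneg_of_le_pi dist_nonneg (by linarith)
          (hxy.trans (le_max_left _ _))⟩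
    have hb : ∀ᶠ n in atTop, dist q (convexResolvent (fun x => (lam n : EReal) * f x) (y n)) < r :=
      (eventually_lt_of_limsup_lt hr1).mono fun n hn => EReal.coe_lt_coe_iff.1 hn
    obtain ⟨p, hp, -⟩ := hf.exists_mem_argminSet hX hadm q (hcos r hr2).1 (fun x A hx ε hε => by
      obtain ⟨n, hn1, hn2⟩ := ((hf.eventually_convexResolvent_le hX hadm hlam_pos hlam
        (hcos ρ hρ2).1 (fun n => (hcos ρ hρ2).2 _ _
          (EReal.coe_le_coe_iff.1 ((le_iSup (fun n => ((dist (convexResolvent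
            (fun x => (lam n : EReal) * f x) (y n)) (y n) : ℝ) : EReal)) n).trans hρ1.le)))
        hx hε).and hb).exists
      exact ⟨_, hn1, by rw [dist_comm]; exact (hcos r hr2).2 _ _ hn2.le⟩)
    exact ⟨p, hp⟩
  · intro hne hα0 hsum
    have hconv := hf.isMidpointConvex_argminSet
    obtain ⟨p, hp⟩ := hconv.exists_isMetricProjection hX hadm hf.isClosed_argminSet hne v
    refine ⟨p, hp, fun q hq => hconv.eq_of_isMetricProjection hX hadm hp hq, ?_⟩
    obtain ⟨k, hk, hkn⟩ := hf.exists_le_cos_dist hX hadm hα hlam_pos hy hp.1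
    have happrox : ∀ (x : X) (A : ℝ), f x ≤ (A : EReal) → ∀ ε > 0, ∀ᶠ n in atTop,
        f (convexResolvent (fun x => (lam n : EReal) * f x) (y n)) ≤ ((A + ε : ℝ) : EReal) :=
      fun x A hx ε hε => hf.eventually_convexResolvent_le hX hadm hlam_pos hlam hk
        (fun n => (hkn n).2) hx hε
    have hzy : ∀ n, Real.cos (dist (y n) p) ≤
        Real.cos (dist (convexResolvent (fun x => (lam n : EReal) * f x) (y n)) p) := fun n => by
      have := (hf.const_mul (hlam_pos n)).cos_dist_le_convexResolvent hX hadm (y n)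
        (mem_argminSet_const_mul (hlam_pos n) hp.1)
      rw [dist_comm _ p, dist_comm _ p]
      exact this.trans (mul_le_of_le_one_left (hadm.cos_dist_pos _ _).le (Real.cos_le_one _))
    set z := fun n => convexResolvent (fun x => (lam n : EReal) * f x) (y n) with hzdef
    have hc := hadm.cos_dist_pos v p
    have hc1 := Real.cos_le_one (dist v p)
    set c := Real.cos (dist v p) with hcdef
    -- Otherwise infinitely many `z n` form a minimizing sequence in a ball about `v` smaller than
    -- `d(v,p)`, producing a minimizer closer than `p`.
    have hfar : ∀ δ > 0, ∀ᶠ n in atTop, Real.cos (dist v (z n)) ≤ c + δ := by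
      intro δ hδ
      by_contra hcon
      rw [not_eventually] at hcon
      obtain ⟨p', hp', hp'c⟩ := hf.exists_mem_argminSet hX hadm v (k := c + δ) (by linarith)
        (fun x A hx ε hε => by
          obtain ⟨n, hn1, hn2⟩ := (hcon.and_eventually (happrox x A hx ε hε)).exists
          exact ⟨z n, hn2, by rw [dist_comm]; exact (not_le.1 hn1).le⟩)
      have := Real.cos_le_cos_of_nonneg_of_le_pi dist_nonneg (by linarith [hadm v p'])
        (hp.2 p' hp')
      rw [dist_comm p' v] at hp'c
      linarith
    have hy0 : Tendsto (fun n => 1 - Real.cos (dist (y n) p)) atTop (𝓝 0) := by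
      have hmax : ∀ ε : ℝ, 0 < ε → ε < 1 →
          Tendsto (fun n => max (1 - Real.cos (dist (y n) p) - ε) 0) atTop (𝓝 0) := by
        intro ε hε hε1
        -- The slack `ε * c` is shared: half absorbs `δ`, and `α n ≤ c * ε / 4` makes the errors `α
        -- n` and `α n * c` fit in the other half.
        have hδ : 0 < ε * c / 2 := by positivity
        refine tendsto_zero_of_le_one_sub_mul (b := fun n => α n ^ 2 / 4)
          (fun n => le_max_right _ _) ?_ ?_
        · filter_upwards [hfar _ hδ, hα0.eventually_le_const
            (show (0 : ℝ) < c * ε / 4 by positivity)] with n hn hαn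
          have hεc : ε * c ≤ ε := mul_le_of_le_one_right hε.le hc1
          have ha := hα n
          have hD := dist_nonneg (x := v) (y := z n)
          have hD2 : dist v (z n) ≤ 2 := by linarith [hadm v (z n), Real.pi_le_four]
          have haD : 0 ≤ α n * dist v (z n) := mul_nonneg ha.1 hD
          have haD2 : α n * dist v (z n) ≤ α n * 2 := mul_le_mul_of_nonneg_left hD2 ha.1
          have hlip : ∀ s t : ℝ, Real.cos s - Real.cos t ≤ |s - t| := fun s t =>
            (le_abs_self _).trans (by
              simpa [Real.dist_eq] using Real.lipschitzWith_cos.dist_le_mul s t)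
          refine ((hy n).max_sub_le hX hadm ha (p := p) (ε := ε) ?_ ?_).trans ?_
          · intro hvz
            change v = z n at hvz
            rw [← hvz, dist_self, Real.cos_zero] at hn
            linarith
          · change Real.cos (dist v (z n) - α n * dist v (z n) / 2) * (1 - ε) ≤
              Real.cos (α n * dist v (z n) / 2) * c
            have h1 : Real.cos (dist v (z n) - α n * dist v (z n) / 2) ≤ c + ε * c / 2 + α n := by
              have := hlip (dist v (z n) - α n * dist v (z n) / 2) (dist v (z n))
              rw [sub_sub_cancel_left, abs_neg, abs_of_nonneg (by linarith)] at this
              linarith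
            have h2 : 1 - α n ≤ Real.cos (α n * dist v (z n) / 2) := by
              have := hlip 0 (α n * dist v (z n) / 2)
              rw [zero_sub, abs_neg, abs_of_nonneg (by linarith), Real.cos_zero] at this
              linarith
            have h3 := mul_le_mul_of_nonneg_right h1 (show 0 ≤ 1 - ε by linarith)
            have h4 := mul_le_mul_of_nonneg_right h2 hc.le
            have h5 : α n * c ≤ α n := mul_le_of_le_one_right ha.1 hc1
            nlinarith [mul_nonneg ha.1 hε.le, mul_nonneg hε.le hδ.le]
          · refine mul_le_mul_of_nonneg_left (max_le_max ?_ le_rfl) ?_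
            · linarith [hzy n]
            · nlinarith [ha.1, ha.2]
        · simp only [div_eq_mul_inv, ← Finset.sum_mul]
          exact hsum.atTop_mul_const (by norm_num)
      rw [Metric.tendsto_atTop]
      intro ε hε
      -- `hmax` needs its parameter below `1`; one half pays for the offset and the other for
      -- convergence.
      have hmin : 0 < min ε 1 := lt_min hε one_pos
      obtain ⟨N, hN⟩ := Metric.tendsto_atTop.1 (hmax (min ε 1 / 2) (by linarith)
        (by linarith [min_le_right ε 1])) (min ε 1 / 2) (by linarith)
      refine ⟨N, fun n hn => ?_⟩
      have h1 := hN n hn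
      rw [Real.dist_eq, sub_zero] at h1 ⊢
      rw [abs_of_nonneg (le_max_right _ _)] at h1
      rw [abs_of_nonneg (by linarith [Real.cos_le_one (dist (y n) p)])]
      linarith [le_max_left (1 - Real.cos (dist (y n) p) - min ε 1 / 2) 0, min_le_left ε 1]
    refine ⟨hadm.tendsto_of_tendsto_cos_dist hy0, hadm.tendsto_of_tendsto_cos_dist ?_⟩
    exact squeeze_zero (fun n => by linarith [Real.cos_le_one (dist (z n) p)])
      (fun n => by linarith [hzy n]) hy0
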